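/- Let $K$ be a number field with exactly one real place and exactly one complex place ($s=t=1$). Let $\mathcal{O}_K^{\times,+}$ be the group of totally positive units of $K$ (units of $\mathcal{O}_K$ that are positive under every real embedding of $K$), and let $u$ be a totally positive fundamental unit, i.e. a generator of $\mathcal{O}_K^{\times,+}$. For $n\ge 1$ put $U_n:=\langle u^n\rangle\subseteq\mathcal{O}_K^{\times,+}$. Call a subgroup $U\subseteq \mathcal{O}_K^{\times,+}$ *admissible* if it is free abelian of rank $s$ and its image under $v\mapsto(\log\sigma_1(v),\dots,\log\sigma_s(v))$ is a full lattice in $\mathbb{R}^s$, where $\sigma_1,\dots,\sigma_s$ are the real embeddings. Let $$X(K,U):=(\mathbb{H}^s\times\mathbb{C}^t)/(\mathcal{O}_K\rtimes U)$$ be the Oeljeklaus–Toma manifold, where $\mathbb{H}$ is the upper half plane, $U$ acts on $(\mathcal{O}_K,+)$ by multiplication, and $(a,b)\in\mathcal{O}_K\rtimes U$ acts by $(z_i)_i\mapsto(\sigma_i(b)z_i+\sigma_i(a))_i$, with $\sigma_{s+1},\dots,\sigma_{s+t}$ one representative of each pair of complex conjugate non-real embeddings. Then: 1. $U_n$ is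 admissible for every $n\ge 1$. 2. For $X_n:=X(K,U_n)$, the torsion subgroup $H_1(X_n,\mathbb{Z})_{\mathrm{tor}}$ of the first singular homology group is finite for every $n\ge 1$, and $$\lim_{n\to\infty}\frac{\log|H_1(X_n,\mathbb{Z})_{\mathrm{tor}}|}{n}=\log M(f),$$ where $f$ is the minimal polynomial of $u$ over $\mathbb{Q}$ and $M(f)$ is its Mahler measure. 3. The order of the torsion subgroup grows exponentially: $M(f)>1$, and $|H_1(X_n,\mathbb{Z})_{\mathrm{tor}}|\sim M(f)^n$ as $n\to\infty$, i.e. the ratio of the two sides tends to $1$. -/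

import Mathlib

open NumberField Filter
open scoped UpperHalfPlane

noncomputable section

namespace OT

universe u

/-- The group `𝒪_K^{×,+}` of totally positive units: the units of the ring of integers which
are positive under every real embedding of `K`. -/
def totallyPositiveUnits (K : Type u) [Field K] [NumberField K] : Subgroup (𝓞 K)ˣ where
  carrier := {v | ∀ σ : K →+* ℝ, 0 < σ ((v : 𝓞 K) : K)}
  one_mem' := fun σ => by simp
  mul_mem' := fun {a b} ha hb σ => by simpa using mul_pos (ha σ) (hb σ)
  inv_mem' := fun {a} ha σ => by
    have h : σ ((a : 𝓞 K) : K) * σ (((a⁻¹ : (𝓞 K)ˣ) : 𝓞 K) : K) = 1 := by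
      rw [← map_mul, ← map_mul, Units.mul_inv, map_one, map_one]
    exact pos_of_mul_pos_right (by rw [h]; exact one_pos) (ha σ).le

/-- The index set of the real embeddings `σ_1, …, σ_s` of `K`. -/
abbrev RealPlace (K : Type u) [Field K] : Type u :=
  {w : InfinitePlace K // w.IsReal}

/-- The index set of the conjugate pairs of non-real complex embeddings of `K`. -/
abbrev ComplexPlace (K : Type u) [Field K] : Type u :=
  {w : InfinitePlace K // w.IsComplex}

/-- The real embedding attached to a real place. -/
abbrev realEmb {K : Type u} [Field K] (w : RealPlace K) : K →+* ℝ :=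
  InfinitePlace.embedding_of_isReal w.2

/-- The chosen representative of a pair of conjugate complex embeddings. -/
abbrev complexEmb {K : Type u} [Field K] (w : ComplexPlace K) : K →+* ℂ :=
  w.1.embedding

/-- The homomorphism `v ↦ (log σ_1(v), …, log σ_s(v))` from the totally positive units to `ℝ^s`,
i.e. the logarithmic embedding followed by the projection to the real coordinates. -/
def realLog (K : Type u) [Field K] [NumberField K] :
    Additive (totallyPositiveUnits K) →+ (RealPlace K → ℝ) where
  toFun v := fun w => Real.log (realEmb w (((v.toMul : (𝓞 K)ˣ) : 𝓞 K) : K))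
  map_zero' := by ext w; simp
  map_add' := fun a b => by
    ext w
    simp only [toMul_add, Subgroup.coe_mul, Units.val_mul, map_mul, Pi.add_apply]
    exact Real.log_mul (a.toMul.2 (realEmb w)).ne' (b.toMul.2 (realEmb w)).ne'

/-- A subgroup `U` of the totally positive units is admissible if it is free abelian of rank `s`,
the number of real places, and its image under the logarithmic embedding followed by the
projection to the real coordinates is a full lattice in `ℝ^s`. -/
structure IsAdmissible {K : Type u} [Field K] [NumberField K]
    (U : Subgroup (totallyPositiveUnits K)) : Prop where
  free : Module.Free ℤ (Additive U)
  finite : Module.Finite ℤ (Additive U)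
  rank_eq : Module.finrank ℤ (Additive U) = InfinitePlace.nrRealPlaces K
  discrete : DiscreteTopology ((Subgroup.toAddSubgroup U).map (realLog K))
  span_eq_top : Submodule.span ℝ
    ((Subgroup.toAddSubgroup U).map (realLog K) : Set (RealPlace K → ℝ)) = ⊤

/-- The action of `U` on the additive group `(𝒪_K, +)` by multiplication. -/
def mulAction {K : Type u} [Field K] [NumberField K] (U : Subgroup (totallyPositiveUnits K)) :
    U →* MulAut (Multiplicative (𝓞 K)) where
  toFun b := AddEquiv.toMultiplicative
    (DistribMulAction.toAddEquiv (𝓞 K) ((b : totallyPositiveUnits K) : (𝓞 K)ˣ))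
  map_one' := by ext a; simp
  map_mul' := fun b c => by ext a; simp [mul_smul]

/-- The semidirect product `π = 𝒪_K ⋊ U`. -/
abbrev OTGroup {K : Type u} [Field K] [NumberField K] (U : Subgroup (totallyPositiveUnits K)) :
    Type u :=
  Multiplicative (𝓞 K) ⋊[mulAction U] U

/-- The space `ℍ^s × ℂ^t`. -/
abbrev Cover (K : Type u) [Field K] : Type u :=
  (RealPlace K → ℍ) × (ComplexPlace K → ℂ)

/-- The action of `𝒪_K ⋊ U` on `ℍ^s × ℂ^t`: the pair `(a, b)` sends `(z_i)` to
`(σ_i(b) z_i + σ_i(a))`. -/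
instance coverAction {K : Type u} [Field K] [NumberField K] (U : Subgroup (totallyPositiveUnits K)) :
    MulAction (OTGroup U) (Cover K) where
  smul g z :=
    (fun w => realEmb w ((g.left.toAdd : 𝓞 K) : K) +ᵥ
      ((⟨realEmb w (((((g.right : totallyPositiveUnits K) : (𝓞 K)ˣ) : 𝓞 K)) : K),
        (g.right : totallyPositiveUnits K).2 (realEmb w)⟩ : {x : ℝ // 0 < x}) • z.1 w),
     fun w => complexEmb w (((((g.right : totallyPositiveUnits K) : (𝓞 K)ˣ) : 𝓞 K)) : K) * z.2 w
      + complexEmb w ((g.left.toAdd : 𝓞 K) : K))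
  one_smul z := by
    refine Prod.ext (funext fun w => UpperHalfPlane.ext ?_) (funext fun w => ?_)
    · change ((realEmb w (((1 : OTGroup U).left.toAdd : 𝓞 K) : K) +ᵥ
        ((⟨realEmb w _, _⟩ : {x : ℝ // 0 < x}) • z.1 w) : ℍ) : ℂ) = _
      simp
    · change complexEmb w _ * z.2 w + complexEmb w _ = _
      simp
  mul_smul g h z := by
    refine Prod.ext (funext fun w => UpperHalfPlane.ext ?_) (funext fun w => ?_)
    · change ((realEmb w (((g * h).left.toAdd : 𝓞 K) : K) +ᵥ
        ((⟨realEmb w _, _⟩ : {x : ℝ // 0 < x}) • z.1 w) : ℍ) : ℂ) =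
        ((realEmb w ((g.left.toAdd : 𝓞 K) : K) +ᵥ
        ((⟨realEmb w _, _⟩ : {x : ℝ // 0 < x}) •
        ((realEmb w ((h.left.toAdd : 𝓞 K) : K) +ᵥ
        ((⟨realEmb w _, _⟩ : {x : ℝ // 0 < x}) • z.1 w) : ℍ))) : ℍ) : ℂ)
      simp [mulAction, Units.smul_def]
      ring
    · change complexEmb w _ * z.2 w + complexEmb w _ =
        complexEmb w _ * (complexEmb w _ * z.2 w + complexEmb w _) + complexEmb w _
      simp [mulAction, Units.smul_def]
      ring

/-- The topological space underlying the Oeljeklaus–Toma manifold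
`X(K, U) = (ℍ^s × ℂ^t) / (𝒪_K ⋊ U)`, with the quotient topology. -/
abbrev X {K : Type u} [Field K] [NumberField K] (U : Subgroup (totallyPositiveUnits K)) : Type u :=
  MulAction.orbitRel.Quotient (OTGroup U) (Cover K)

/-- The first singular homology group `H_1(S, ℤ)` of a topological space `S`. -/
abbrev H1 (S : Type u) [TopologicalSpace S] : Type u :=
  ((AlgebraicTopology.singularHomologyFunctor (ModuleCat.{u} ℤ) 1).obj
    (ModuleCat.of ℤ (ULift.{u} ℤ))).obj (TopCat.of S)

end OT

end

/-! The cover `ℍ^s × ℂ^t` is a convex set on which `π = 𝒪_K ⋊ ⟨v⟩` acts by affine maps, and the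
quotient is a covering with group `π` when `v` has nonzero logarithm at a real place. Hence `H_1(X)`
is the abelianization of `π`. This is computed directly on singular chains
(`SSet.nonempty_homology_one_addEquiv_abelianization`): edges of `X` lift to the cover, and coning a
lifted edge from a base point replaces it by straight segments, whose images modulo boundaries
depend only on group elements and vertex terms.

Conjugation by `v` is multiplication by `v` on `𝒪_K`, so the abelianization is `𝒪_K / (v - 1) ×
⟨v⟩`. The second factor is torsion-free, and the torsion is `𝒪_K / (v - 1)`, of order `|N(v - 1)|`,
the product of `|v - 1|_w` over the infinite places with multiplicity (`OT.card_torsion_H1_X`).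

For `v = u ^ n` each factor `|u ^ n - 1|_w` is asymptotic to `max 1 |u|_w ^ n`, provided `|u|_w ≠
1`. Since `K` is cubic and `u` is irrational, the conjugates of `u` are its images under all
embeddings, so the product of the `max 1 |u|_w` is the Mahler measure. With one real and one complex
place the norm relation `|u|_{w₀} |u|_{w₁} ^ 2 = 1` and `|u|_{w₀} ≠ 1` exclude conjugates on the
unit circle and force one outside it. The logarithmic limit follows from the asymptotic equivalence.
-/

namespace SSet

/-! ### First homology of simplicial sets. -/

open CategoryTheory Limits Simplicial Opposite

universe u

/-- The integers as the coefficient object of simplicial chains. -/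
abbrev intCoeff : ModuleCat.{u} ℤ := ModuleCat.of ℤ (ULift.{u} ℤ)

/-- The morphism from the integers to a module attached to an element. -/
noncomputable def ofElement {M : ModuleCat.{u} ℤ} (m : M) : intCoeff.{u} ⟶ M :=
  ModuleCat.ofHom ((LinearMap.toSpanSingleton ℤ M m).comp ULift.moduleEquiv.toLinearMap)

lemma ofElement_apply_one {M : ModuleCat.{u} ℤ} (m : M) :
    (ofElement m).hom (ULift.up 1) = m := by
  simp only [ofElement, ModuleCat.hom_ofHom, LinearMap.comp_apply,
    LinearMap.toSpanSingleton_apply, LinearEquiv.coe_coe, ULift.moduleEquiv_apply]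
  exact M.isModule.one_smul m

lemma intCoeff_hom_ext {M : ModuleCat.{u} ℤ} {f g : intCoeff.{u} ⟶ M}
    (h : f.hom (ULift.up 1) = g.hom (ULift.up 1)) : f = g := by
  ext : 1
  apply LinearMap.ext
  rintro ⟨n⟩
  have hn : (ULift.up n : ULift.{u} ℤ) = n • ULift.up 1 := by
    ext; simp
  rw [hn, map_zsmul, map_zsmul, h]

/-- The chain complex of a simplicial set with integral coefficients. -/
noncomputable abbrev intChains (S : SSet.{u}) : ChainComplex (ModuleCat.{u} ℤ) ℕ :=
  S.chainComplex intCoeff.{u}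

variable {S : SSet.{u}}

/-- The chain given by a single simplex. -/
noncomputable def simplexChain {n : ℕ} (x : S _⦋n⦌) : S.intChains.X n :=
  (S.ιChainComplex (R := intCoeff.{u}) x).hom (ULift.up 1)

/-- The class of an edge in the quotient of `1`-chains by boundaries. -/
noncomputable def edgeClass (x : S _⦋1⦌) : S.intChains.opcycles 1 :=
  (S.intChains.pOpcycles 1).hom (simplexChain x)

lemma chain_hom_ext {n : ℕ} {M : ModuleCat.{u} ℤ} {f g : S.intChains.X n ⟶ M}
    (h : ∀ x, f.hom (simplexChain x) = g.hom (simplexChain x)) : f = g :=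
  chainComplex_hom_ext fun x => intCoeff_hom_ext (h x)

lemma d_simplexChain_one (x : S _⦋1⦌) :
    (S.intChains.d 1 0).hom (simplexChain x) =
      simplexChain (S.δ 0 x) - simplexChain (S.δ 1 x) := by
  have h : S.ιChainComplex (R := intCoeff.{u}) x ≫ S.intChains.d 1 0 =
      S.ιChainComplex (S.δ 0 x) - S.ιChainComplex (S.δ 1 x) := by
    rw [S.ιChainComplex_d]
    refine (Fin.sum_univ_two _).trans ?_
    simp [sub_eq_add_neg]
  exact congrArg (fun f => f.hom (ULift.up 1)) h

lemma d_simplexChain_two (x : S _⦋2⦌) :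
    (S.intChains.d 2 1).hom (simplexChain x) =
      simplexChain (S.δ 0 x) - simplexChain (S.δ 1 x) + simplexChain (S.δ 2 x) := by
  have h : S.ιChainComplex (R := intCoeff.{u}) x ≫ S.intChains.d 2 1 =
      S.ιChainComplex (S.δ 0 x) - S.ιChainComplex (S.δ 1 x) + S.ιChainComplex (S.δ 2 x) := by
    rw [S.ιChainComplex_d]
    refine (Fin.sum_univ_three _).trans ?_
    simp [sub_eq_add_neg]
  exact congrArg (fun f => f.hom (ULift.up 1)) h

lemma edgeClass_δ (t : S _⦋2⦌) :
    edgeClass (S.δ 1 t) = edgeClass (S.δ 0 t) + edgeClass (S.δ 2 t) := by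
  have h : (S.intChains.pOpcycles 1).hom ((S.intChains.d 2 1).hom (simplexChain t)) = 0 :=
    congrArg (fun f => f.hom (simplexChain t)) (S.intChains.d_pOpcycles 2 1)
  rw [d_simplexChain_two, map_add, map_sub] at h
  change edgeClass (S.δ 0 t) - edgeClass (S.δ 1 t) + edgeClass (S.δ 2 t) = 0 at h
  rw [← sub_eq_zero, ← neg_eq_zero, ← h]
  abel

lemma fromOpcycles_edgeClass (x : S _⦋1⦌) :
    (S.intChains.fromOpcycles 1 0).hom (edgeClass x) =
      simplexChain (S.δ 0 x) - simplexChain (S.δ 1 x) :=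
  (congrArg (fun f => f.hom (simplexChain x)) (S.intChains.p_fromOpcycles 1 0)).trans
    (d_simplexChain_one x)

lemma exists_chain_lift {n : ℕ} {M : ModuleCat.{u} ℤ} (f : S _⦋n⦌ → M) :
    ∃ F : S.intChains.X n ⟶ M, ∀ x, F.hom (simplexChain x) = f x := by
  refine ⟨(S.isColimitChainComplexXCofan intCoeff.{u} n).desc
    (Cofan.mk M fun x => ofElement (f x)), fun x => ?_⟩
  have h := (S.isColimitChainComplexXCofan intCoeff.{u} n).fac
    (Cofan.mk M fun x => ofElement (f x)) ⟨x⟩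
  exact (congrArg (fun f => f.hom (ULift.up 1)) h).trans (ofElement_apply_one (f x))

/-- Chains are free on simplices, and the cocycle identity says that the extension of `φ` kills the
boundary of every triangle. -/
lemma exists_opcycles_lift {M : ModuleCat.{u} ℤ} (φ : S _⦋1⦌ → M)
    (hφ : ∀ t : S _⦋2⦌, φ (S.δ 1 t) = φ (S.δ 0 t) + φ (S.δ 2 t)) :
    ∃ F : S.intChains.opcycles 1 ⟶ M, ∀ x, F.hom (edgeClass x) = φ x := by
  obtain ⟨F, hF⟩ := exists_chain_lift φ
  have hd : S.intChains.d 2 1 ≫ F = 0 := by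
    apply chain_hom_ext
    intro t
    change F.hom ((S.intChains.d 2 1).hom (simplexChain t)) = 0
    rw [d_simplexChain_two, map_add, map_sub, hF, hF, hF, hφ]
    abel
  refine ⟨S.intChains.descOpcycles F 2 (by simp) hd, fun x => ?_⟩
  exact (congrArg (fun f => f.hom (simplexChain x))
    (S.intChains.p_descOpcycles F 2 (by simp) hd)).trans (hF x)

lemma opcycles_hom_ext {M : ModuleCat.{u} ℤ} {f g : S.intChains.opcycles 1 ⟶ M}
    (h : ∀ x, f.hom (edgeClass x) = g.hom (edgeClass x)) : f = g := by
  rw [← cancel_epi (S.intChains.pOpcycles 1)]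
  exact chain_hom_ext h

/-- A criterion for the first homology group of a simplicial set to be isomorphic to `A`: an
`A`-valued `1`-cocycle `φ` and a map `ψ` from `A` to `1`-cycles modulo boundaries which are
inverse to each other up to vertex terms. -/
theorem nonempty_homology_one_addEquiv {A : Type u} [AddCommGroup A] (φ : S _⦋1⦌ → A)
    (hφ : ∀ t : S _⦋2⦌, φ (S.δ 1 t) = φ (S.δ 0 t) + φ (S.δ 2 t))
    (ψ : A →+ S.intChains.opcycles 1)
    (hψ : ∀ a, (S.intChains.fromOpcycles 1 0).hom (ψ a) = 0)
    (hφψ : ∀ a, ∃ x, ψ a = edgeClass x ∧ φ x = a)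
    (e : S _⦋0⦌ → S.intChains.opcycles 1)
    (he : ∀ x, edgeClass x = ψ (φ x) + (e (S.δ 0 x) - e (S.δ 1 x))) :
    Nonempty (S.intChains.homology 1 ≃+ A) := by
  obtain ⟨Φ, hΦ⟩ := exists_opcycles_lift (M := ModuleCat.of ℤ A) φ hφ
  obtain ⟨E, hE⟩ := exists_chain_lift e
  let Ψ : ModuleCat.of ℤ A ⟶ S.intChains.opcycles 1 := ModuleCat.ofHom
    { toFun := ψ
      map_add' := map_add ψ
      map_smul' := fun n a => map_intCast_smul ψ ℤ ℤ n a }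
  have hΨ : Ψ ≫ S.intChains.fromOpcycles 1 0 = 0 := by
    ext a
    exact hψ a
  let L : ModuleCat.of ℤ A ⟶ S.intChains.homology 1 :=
    (S.intChains.homologyIsKernel 1 0 (by simp)).lift (KernelFork.ofι Ψ hΨ)
  have hL : L ≫ S.intChains.homologyι 1 = Ψ :=
    (S.intChains.homologyIsKernel 1 0 (by simp)).fac (KernelFork.ofι Ψ hΨ) WalkingParallelPair.zero
  have hΨΦ : Ψ ≫ Φ = 𝟙 _ := by
    ext a
    obtain ⟨x, hx, hxa⟩ := hφψ a
    change Φ.hom (ψ a) = a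
    rw [hx, hΦ, hxa]
  -- The correction term factors through the boundary map, so it vanishes on homology, which is the
  -- kernel of `fromOpcycles`.
  have hΦΨ : 𝟙 _ = Φ ≫ Ψ + S.intChains.fromOpcycles 1 0 ≫ E := by
    apply opcycles_hom_ext
    intro x
    change edgeClass x = ψ (Φ.hom (edgeClass x)) +
      E.hom ((S.intChains.fromOpcycles 1 0).hom (edgeClass x))
    rw [hΦ, fromOpcycles_edgeClass, map_sub, hE, hE]
    exact he x
  let i : S.intChains.homology 1 ≅ ModuleCat.of ℤ A :=
    { hom := S.intChains.homologyι 1 ≫ Φ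
      inv := L
      hom_inv_id := by
        rw [← cancel_mono (S.intChains.homologyι 1), Category.assoc, Category.assoc, hL, Category.id_comp]
        have h := congrArg (fun f => S.intChains.homologyι 1 ≫ f) hΦΨ
        simpa only [Category.comp_id, Preadditive.comp_add, ← Category.assoc,
          S.intChains.homologyι_comp_fromOpcycles, zero_comp, add_zero] using h.symm
      inv_hom_id := by rw [← Category.assoc, hL, hΨΦ] }
  exact ⟨i.toLinearEquiv.toAddEquiv⟩

/-- Fix a representative of each orbit; by freeness a unique group element carries it to `y`, and
uniqueness gives equivariance. -/
lemma exists_equivariant_map {G Y : Type*} [Group G] [MulAction G Y]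
    (hfree : ∀ (g : G) (y : Y), g • y = y → g = 1) :
    ∃ c : Y → G, ∀ (g : G) (y : Y), c (g • y) = g * c y := by
  have h (y : Y) : ∃ g : G, g • (Quotient.out (Quotient.mk (MulAction.orbitRel G Y) y)) = y :=
    MulAction.orbitRel_apply.1 ((MulAction.orbitRel G Y).symm
      (Quotient.exact (Quotient.out_eq (Quotient.mk (MulAction.orbitRel G Y) y))))
  choose c hc using h
  refine ⟨c, fun g y => ?_⟩
  have hq : Quotient.mk (MulAction.orbitRel G Y) (g • y) = Quotient.mk (MulAction.orbitRel G Y) y :=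
    Quotient.sound (MulAction.orbitRel_apply.2 ⟨g, rfl⟩)
  have h1 := hc (g • y)
  rw [hq] at h1
  have h2 : (g * c y) • (Quotient.out (Quotient.mk (MulAction.orbitRel G Y) y)) = g • y := by
    rw [mul_smul, hc]
  have h3 : (c (g • y))⁻¹ * (g * c y) = 1 := by
    refine hfree _ (Quotient.out (Quotient.mk (MulAction.orbitRel G Y) y)) ?_
    rw [mul_smul, h2, inv_smul_eq_iff, h1]
  exact inv_mul_eq_one.1 h3

/-- If `p : T ⟶ S` behaves on simplices of dimension at most two like a regular covering with
group `G`, and `T` has an equivariant choice of edges between any two vertices and fillings of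
triangles over edges, then the first homology of `S` is the abelianization of `G`. -/
theorem nonempty_homology_one_addEquiv_abelianization {T S : SSet.{u}} (p : T ⟶ S)
    {G : Type u} [Group G] [MulAction G (T _⦋0⦌)]
    (hfree : ∀ (g : G) (a : T _⦋0⦌), g • a = a → g = 1)
    (hsmul : ∀ (g : G) (a : T _⦋0⦌), p.app (op ⦋0⦌) (g • a) = p.app (op ⦋0⦌) a)
    (h0 : ∀ x : S _⦋0⦌, ∃ a : T _⦋0⦌, p.app (op ⦋0⦌) a = x)
    (h0' : ∀ a b : T _⦋0⦌, p.app (op ⦋0⦌) a = p.app (op ⦋0⦌) b → ∃ g : G, b = g • a)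
    (h1 : ∀ x : S _⦋1⦌, ∃ a : T _⦋1⦌, p.app (op ⦋1⦌) a = x)
    (h1' : ∀ a b : T _⦋1⦌, p.app (op ⦋1⦌) a = p.app (op ⦋1⦌) b →
      ∃ g : G, T.δ 0 b = g • T.δ 0 a ∧ T.δ 1 b = g • T.δ 1 a)
    (h2 : ∀ x : S _⦋2⦌, ∃ a : T _⦋2⦌, p.app (op ⦋2⦌) a = x)
    (seg : T _⦋0⦌ → T _⦋0⦌ → T _⦋1⦌)
    (seg_zero : ∀ a b, T.δ 0 (seg a b) = b) (seg_one : ∀ a b, T.δ 1 (seg a b) = a)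
    (hseg : ∀ (g : G) (a b), p.app (op ⦋1⦌) (seg (g • a) (g • b)) = p.app (op ⦋1⦌) (seg a b))
    (hcone : ∀ (a : T _⦋0⦌) (x : T _⦋1⦌), ∃ t : T _⦋2⦌, T.δ 0 t = x ∧
      T.δ 1 t = seg a (T.δ 0 x) ∧ T.δ 2 t = seg a (T.δ 1 x))
    (y : T _⦋0⦌) :
    Nonempty (S.intChains.homology 1 ≃+ Additive (Abelianization G)) := by
  obtain ⟨c, hc⟩ := exists_equivariant_map hfree
  -- The chosen representative of the orbit of `a`.
  let s (a : T _⦋0⦌) : T _⦋0⦌ := (c a)⁻¹ • a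
  have hs (g : G) (a) : s (g • a) = s a := by
    simp only [s, hc, mul_inv_rev, mul_smul, inv_smul_smul]
  let seg' (a b : T _⦋0⦌) : S.intChains.opcycles 1 := edgeClass (p.app (op ⦋1⦌) (seg a b))
  have hseg' (g : G) (a b) : seg' (g • a) (g • b) = seg' a b :=
    congrArg edgeClass (hseg g a b)
  -- The cone from `a` over `x` expresses the class of `x` through segments alone.
  have hcl (a : T _⦋0⦌) (x : T _⦋1⦌) :
      edgeClass (p.app (op ⦋1⦌) x) = seg' a (T.δ 0 x) - seg' a (T.δ 1 x) := by
    obtain ⟨t, ht0, ht1, ht2⟩ := hcone a x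
    have h := edgeClass_δ (p.app (op ⦋2⦌) t)
    rw [← δ_naturality_apply, ← δ_naturality_apply, ← δ_naturality_apply, ht0, ht1, ht2] at h
    exact eq_sub_of_add_eq h.symm
  have hadd (a b d) : seg' a d = seg' a b + seg' b d := by
    have h := hcl a (seg b d)
    rw [seg_zero, seg_one] at h
    change seg' b d = _ at h
    rw [h]; abel
  -- Additivity: the segment from `g • y` to `g • h • y` has the same image as the one from `y` to
  -- `h • y`.
  let ψ₀ : G →* Multiplicative (S.intChains.opcycles 1) :=
    MonoidHom.mk' (fun g => Multiplicative.ofAdd (seg' y (g • y))) fun g h => by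
      rw [← ofAdd_add, mul_smul, hadd y (g • y), hseg']
  let ψ : Additive (Abelianization G) →+ S.intChains.opcycles 1 :=
    MonoidHom.toAdditiveLeft (Abelianization.lift ψ₀)
  have hψ (g : G) : ψ (Additive.ofMul (Abelianization.of g)) = seg' y (g • y) := rfl
  -- The change of the `G`-coordinate along an edge. Translating the edge by `g` adds the class of
  -- `g` at both ends, so in the abelianization the value depends only on the image in `S`.
  let v (a : T _⦋1⦌) : Additive (Abelianization G) :=
    Additive.ofMul (Abelianization.of (c (T.δ 0 a))) -
      Additive.ofMul (Abelianization.of (c (T.δ 1 a)))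
  have hv (a b) (h : p.app (op ⦋1⦌) a = p.app (op ⦋1⦌) b) : v a = v b := by
    obtain ⟨g, hg0, hg1⟩ := h1' a b h
    simp only [v, hg0, hg1, hc, map_mul, ofMul_mul]
    abel
  choose l1 hl1 using h1
  choose l0 hl0 using h0
  refine nonempty_homology_one_addEquiv (fun x => v (l1 x)) ?_ ψ ?_ ?_
    (fun x => seg' y (s (l0 x))) ?_
  · intro t
    obtain ⟨t, rfl⟩ := h2 t
    have hl (i : Fin 3) : v (l1 (S.δ i (p.app (op ⦋2⦌) t))) = v (T.δ i t) := by
      apply hv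
      rw [hl1, δ_naturality_apply]
    rw [hl, hl, hl]
    have e1 : T.δ 0 (T.δ 1 t) = T.δ 0 (T.δ 0 t) :=
      T.δ_comp_δ_apply (i := 0) (j := 0) le_rfl t
    have e2 : T.δ 0 (T.δ 2 t) = T.δ 1 (T.δ 0 t) :=
      T.δ_comp_δ_apply (i := 0) (j := 1) (by simp) t
    have e3 : T.δ 1 (T.δ 2 t) = T.δ 1 (T.δ 1 t) :=
      T.δ_comp_δ_apply (i := 1) (j := 1) le_rfl t
    simp only [v, e1, e2, e3]
    abel
  · intro a
    obtain ⟨g, rfl⟩ : ∃ g : G, Additive.ofMul (Abelianization.of g) = a := by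
      obtain ⟨g, hg⟩ := QuotientGroup.mk_surjective a.toMul
      exact ⟨g, congrArg Additive.ofMul hg⟩
    rw [hψ]
    change (S.intChains.fromOpcycles 1 0).hom (edgeClass _) = 0
    rw [fromOpcycles_edgeClass, ← δ_naturality_apply, ← δ_naturality_apply, seg_zero, seg_one,
      hsmul, sub_self]
  · intro a
    obtain ⟨g, rfl⟩ : ∃ g : G, Additive.ofMul (Abelianization.of g) = a := by
      obtain ⟨g, hg⟩ := QuotientGroup.mk_surjective a.toMul
      exact ⟨g, congrArg Additive.ofMul hg⟩
    refine ⟨p.app (op ⦋1⦌) (seg y (g • y)), hψ g, ?_⟩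
    rw [hv _ (seg y (g • y)) (hl1 _)]
    simp only [v, seg_zero, seg_one, hc, map_mul, ofMul_mul, add_sub_cancel_right]
  · intro x
    obtain ⟨a, rfl⟩ : ∃ a, p.app (op ⦋1⦌) a = x := ⟨_, hl1 x⟩
    have he (b : T _⦋0⦌) : s (l0 (p.app (op ⦋0⦌) b)) = s b := by
      obtain ⟨g, hg⟩ := h0' b (l0 (p.app (op ⦋0⦌) b)) (hl0 _).symm
      rw [hg, hs]
    -- The path from `y` to `b` is broken at `c b • y`; the second half is a translate of the
    -- segment from `y` to `s b`, which is the vertex term.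
    have hb (b : T _⦋0⦌) : seg' y b = seg' y (c b • y) + seg' y (s b) := by
      rw [← hseg' (c b) y (s b), ← hadd]
      simp only [s, smul_inv_smul]
    rw [hv _ a (hl1 _), ← δ_naturality_apply, ← δ_naturality_apply, he, he, map_sub, hψ, hψ,
      hcl y a, hb (T.δ 0 a), hb (T.δ 1 a)]
    abel

end SSet

namespace OT

/-! ### Singular homology of quotients of convex spaces. -/

section SingularHomology

open CategoryTheory Limits Simplicial Opposite

universe u

section Simplices

/-- Singular simplices of a space as continuous maps from the standard simplex. -/
noncomputable def singularEquiv (X : Type u) [TopologicalSpace X] (n : ℕ) :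
    (TopCat.toSSet.obj (TopCat.of X)) _⦋n⦌ ≃ C(stdSimplex ℝ (Fin (n + 1)), X) :=
  TopCat.toSSetObjEquiv (TopCat.of X) (op ⦋n⦌)

lemma singularEquiv_δ {X : Type u} [TopologicalSpace X] {n : ℕ} (i : Fin (n + 2))
    (x : (TopCat.toSSet.obj (TopCat.of X)) _⦋n + 1⦌) (s : stdSimplex ℝ (Fin (n + 1))) :
    singularEquiv X n ((TopCat.toSSet.obj (TopCat.of X)).δ i x) s =
      singularEquiv X (n + 1) x (stdSimplex.map (Fin.succAbove i) s) :=
  rfl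

lemma stdSimplex_map_succAbove_zero_coe (s : stdSimplex ℝ (Fin 2)) :
    (stdSimplex.map (Fin.succAbove (0 : Fin 3)) s : Fin 3 → ℝ) = ![0, s 0, s 1] := by
  ext j
  rw [stdSimplex.map_coe, FunOnFinite.linearMap_apply_apply, Finset.sum_filter, Fin.sum_univ_two]
  fin_cases j <;> simp [Fin.succAbove, Fin.ext_iff]

lemma stdSimplex_map_succAbove_one_coe (s : stdSimplex ℝ (Fin 2)) :
    (stdSimplex.map (Fin.succAbove (1 : Fin 3)) s : Fin 3 → ℝ) = ![s 0, 0, s 1] := by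
  ext j
  rw [stdSimplex.map_coe, FunOnFinite.linearMap_apply_apply, Finset.sum_filter, Fin.sum_univ_two]
  fin_cases j <;> simp [Fin.succAbove, Fin.ext_iff]

lemma stdSimplex_map_succAbove_two_coe (s : stdSimplex ℝ (Fin 2)) :
    (stdSimplex.map (Fin.succAbove (2 : Fin 3)) s : Fin 3 → ℝ) = ![s 0, s 1, 0] := by
  ext j
  rw [stdSimplex.map_coe, FunOnFinite.linearMap_apply_apply, Finset.sum_filter, Fin.sum_univ_two]
  fin_cases j <;> simp [Fin.succAbove, Fin.ext_iff]

lemma stdSimplex_map_succAbove_fin_two (i : Fin 2) (s : stdSimplex ℝ (Fin 1)) :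
    stdSimplex.map (Fin.succAbove i) s = stdSimplex.vertex (S := ℝ) (1 - i) := by
  have hs : s = stdSimplex.vertex 0 := Subsingleton.elim _ _
  rw [hs, stdSimplex.map_vertex]
  fin_cases i <;> rfl

/-- Needed, with local path-connectedness, to lift singular simplices through coverings. -/
instance simplyConnectedSpace_stdSimplex (n : ℕ) :
    SimplyConnectedSpace (stdSimplex ℝ (Fin (n + 1))) :=
  have := (convex_stdSimplex ℝ (Fin (n + 1))).contractibleSpace
    ⟨_, single_mem_stdSimplex ℝ (0 : Fin (n + 1))⟩
  inferInstance

instance locallyPathConnectedSpace_stdSimplex (n : ℕ) :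
    LocallyPathConnectedSpace (stdSimplex ℝ (Fin (n + 1))) :=
  (convex_stdSimplex ℝ (Fin (n + 1))).locallyPathConnectedSpace

end Simplices

section Convex

lemma exists_continuousMap_lift {A Y E : Type*} [TopologicalSpace A] [TopologicalSpace Y]
    [TopologicalSpace E] {ι : Y → E} (hι : Topology.IsEmbedding ι) {f : A → E} (hf : Continuous f)
    (hf' : ∀ a, f a ∈ Set.range ι) : ∃ F : C(A, Y), ∀ a, ι (F a) = f a := by
  choose F hF using hf'
  refine ⟨⟨F, hι.isInducing.continuous_iff.2 ?_⟩, hF⟩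
  convert! hf
  exact funext hF

variable {Y E : Type*} [TopologicalSpace Y] [NormedAddCommGroup E] [NormedSpace ℝ E]
  {ι : Y → E}

lemma exists_segment (hι : Topology.IsEmbedding ι) (hconv : Convex ℝ (Set.range ι)) (a b : Y) :
    ∃ F : C(stdSimplex ℝ (Fin 2), Y), ∀ s, ι (F s) = s 0 • ι a + s 1 • ι b := by
  refine exists_continuousMap_lift hι
    (f := fun s : stdSimplex ℝ (Fin 2) => s 0 • ι a + s 1 • ι b) ?_ fun s =>
    hconv ⟨a, rfl⟩ ⟨b, rfl⟩ (stdSimplex.zero_le s 0) (stdSimplex.zero_le s 1)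
      (stdSimplex.add_eq_one s)
  have h (i : Fin 2) : Continuous fun s : stdSimplex ℝ (Fin 2) => s i :=
    (continuous_apply i).comp continuous_subtype_val
  exact ((h 0).smul continuous_const).add ((h 1).smul continuous_const)

/-- The point of the `1`-simplex with second coordinate the projection of `t` to `[0, 1]`. -/
noncomputable def edgePoint (t : ℝ) : stdSimplex ℝ (Fin 2) :=
  ⟨![1 - (Set.projIcc (0 : ℝ) 1 zero_le_one t : ℝ), Set.projIcc (0 : ℝ) 1 zero_le_one t], by
    have h := (Set.projIcc (0 : ℝ) 1 zero_le_one t).2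
    refine ⟨fun i => ?_, by simp [Fin.sum_univ_two]⟩
    fin_cases i
    · simpa using h.2
    · simpa using h.1⟩

lemma continuous_edgePoint : Continuous edgePoint := by
  refine Continuous.subtype_mk ?_ _
  have h : Continuous fun t : ℝ => (Set.projIcc (0 : ℝ) 1 zero_le_one t : ℝ) :=
    continuous_subtype_val.comp continuous_projIcc
  refine continuous_pi fun i => ?_
  fin_cases i
  · exact continuous_const.sub h
  · exact h

lemma edgePoint_coe (s : stdSimplex ℝ (Fin 2)) : edgePoint (s 1) = s := by
  have h1 : Set.projIcc (0 : ℝ) 1 zero_le_one (s 1) = ⟨s 1, stdSimplex.zero_le s 1, stdSimplex.le_one s 1⟩ :=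
    Set.projIcc_of_mem zero_le_one ⟨stdSimplex.zero_le s 1, stdSimplex.le_one s 1⟩
  have h2 : 1 - s 1 = s 0 := by rw [← stdSimplex.add_eq_one s]; ring
  ext i
  fin_cases i
  · change 1 - (Set.projIcc (0 : ℝ) 1 zero_le_one (s 1) : ℝ) = s 0
    rw [h1]; exact h2
  · change (Set.projIcc (0 : ℝ) 1 zero_le_one (s 1) : ℝ) = s 1
    rw [h1]

/-- The cone over an edge. -/
lemma exists_cone (hι : Topology.IsEmbedding ι) (hconv : Convex ℝ (Set.range ι)) (a : Y) (γ : C(stdSimplex ℝ (Fin 2), Y)) :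
    ∃ F : C(stdSimplex ℝ (Fin 3), Y), ∀ s, ι (F s) =
      s 0 • ι a + (1 - s 0) • ι (γ (edgePoint (s 2 / (1 - s 0)))) := by
  refine exists_continuousMap_lift hι (f := fun s : stdSimplex ℝ (Fin 3) =>
    s 0 • ι a + (1 - s 0) • ι (γ (edgePoint (s 2 / (1 - s 0))))) ?_ fun s =>
    hconv ⟨a, rfl⟩ ⟨_, rfl⟩ (stdSimplex.zero_le s 0) (sub_nonneg.2 (stdSimplex.le_one s 0)) (by ring)
  have h (i : Fin 3) : Continuous fun s : stdSimplex ℝ (Fin 3) => s i :=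
    (continuous_apply i).comp continuous_subtype_val
  have hγ : Continuous fun t => ι (γ (edgePoint t)) :=
    hι.continuous.comp (γ.continuous.comp continuous_edgePoint)
  refine ((h 0).smul continuous_const).add (continuous_iff_continuousAt.2 fun s => ?_)
  -- At the apex the parameter `s 2 / (1 - s 0)` has no limit, but the edge has compact, hence
  -- bounded, image and the factor `1 - s 0` tends to zero.
  by_cases hs : 1 - s 0 = 0
  · obtain ⟨C, hC⟩ := (isCompact_range (hι.continuous.comp γ.continuous)).isBounded.exists_norm_le
    have hbd : ∀ t, ‖ι (γ (edgePoint t))‖ ≤ C := fun t => hC _ ⟨edgePoint t, rfl⟩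
    rw [ContinuousAt, hs, zero_smul]
    have h0 : Tendsto (fun s : stdSimplex ℝ (Fin 3) => 1 - s 0) (nhds s) (nhds 0) :=
      hs ▸ (continuous_const.sub (h 0)).continuousAt
    exact h0.zero_smul_isBoundedUnder_le
      (isBoundedUnder_of ⟨C, fun s => hbd (s 2 / (1 - s 0))⟩)
  · have h1 : ContinuousAt (fun s : stdSimplex ℝ (Fin 3) => 1 - s 0) s :=
      (continuous_const.sub (h 0)).continuousAt
    exact h1.smul (ContinuousAt.comp (g := fun t => ι (γ (edgePoint t))) hγ.continuousAt
      ((h 2).continuousAt.div h1 hs))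

end Convex

/-- The first homology of the quotient of a convex space by a free, properly discontinuous action
by affine maps is the abelianization of the group. -/
theorem nonempty_H1_addEquiv_abelianization {Y X : Type u} [TopologicalSpace Y]
    [TopologicalSpace X] {q : Y → X} {G : Type u} [Group G] [MulAction G Y]
    (hq : IsQuotientCoveringMap q G) {E : Type*} [NormedAddCommGroup E] [NormedSpace ℝ E]
    {ι : Y → E} (hι : Topology.IsEmbedding ι) (hconv : Convex ℝ (Set.range ι))
    (haff : ∀ (g : G) (a b y : Y) (s t : ℝ), s + t = 1 → ι y = s • ι a + t • ι b →
      ι (g • y) = s • ι (g • a) + t • ι (g • b)) (y : Y) :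
    Nonempty (H1 X ≃+ Additive (Abelianization G)) := by
  have hqc := hq.isCoveringMap.continuous
  have := hq.toContinuousConstSMul
  have hcancel := hq.isCancelSMul
  let T := TopCat.toSSet.obj (TopCat.of Y)
  let S := TopCat.toSSet.obj (TopCat.of X)
  let p : T ⟶ S := TopCat.toSSet.map (TopCat.ofHom ⟨q, hqc⟩)
  have hp (n : ℕ) (a : T _⦋n⦌) : singularEquiv X n (p.app (op ⦋n⦌) a) =
      ContinuousMap.comp ⟨q, hqc⟩ (singularEquiv Y n a) := rfl
  have hlift (n : ℕ) (x : S _⦋n⦌) : ∃ a : T _⦋n⦌, p.app (op ⦋n⦌) a = x := by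
    obtain ⟨e, he⟩ := hq.surjective (singularEquiv X n x (stdSimplex.vertex 0))
    obtain ⟨F, ⟨-, hF⟩, -⟩ := hq.isCoveringMap.existsUnique_continuousMap_lifts
      (singularEquiv X n x) (stdSimplex.vertex 0) e he
    refine ⟨(singularEquiv Y n).symm F, (singularEquiv X n).injective ?_⟩
    rw [hp, Equiv.apply_symm_apply]
    exact ContinuousMap.ext fun s => congrFun hF s
  -- Two lifts agree at one vertex after a translation, hence everywhere, the simplex being
  -- connected.
  have huniq (n : ℕ) (a b : T _⦋n⦌) (hab : p.app (op ⦋n⦌) a = p.app (op ⦋n⦌) b) :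
      ∃ g : G, ∀ s, singularEquiv Y n b s = g • singularEquiv Y n a s := by
    have h : ∀ s, q (singularEquiv Y n a s) = q (singularEquiv Y n b s) := fun s =>
      DFunLike.congr_fun (congrArg (singularEquiv X n) hab) s
    obtain ⟨g, hg⟩ := hq.apply_eq_iff_mem_orbit.1 (h (stdSimplex.vertex 0)).symm
    refine ⟨g, congrFun (hq.isCoveringMap.eq_of_comp_eq (singularEquiv Y n b).continuous
      ((singularEquiv Y n a).continuous.const_smul g) (funext fun s => ?_)
      (stdSimplex.vertex 0) hg.symm)⟩
    exact (h s).symm.trans (hq.map_smul g).symm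
  let ev (a : T _⦋0⦌) : Y := singularEquiv Y 0 a (stdSimplex.vertex 0)
  let pt (b : Y) : T _⦋0⦌ := (singularEquiv Y 0).symm (ContinuousMap.const _ b)
  let eqv : T _⦋0⦌ ≃ Y :=
    { toFun := ev
      invFun := pt
      left_inv := fun a => (singularEquiv Y 0).injective (ContinuousMap.ext fun s => by
        rw [Subsingleton.elim s (stdSimplex.vertex 0)]
        simp [pt, ev])
      right_inv := fun b => by simp [pt, ev] }
  let _ : MulAction G (T _⦋0⦌) := eqv.mulAction G
  have hev (g : G) (a : T _⦋0⦌) : ev (g • a) = g • ev a := eqv.apply_symm_apply _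
  have hevp (a : T _⦋0⦌) (s) : singularEquiv X 0 (p.app (op ⦋0⦌) a) s = q (ev a) := by
    rw [Subsingleton.elim s (stdSimplex.vertex 0), hp]
    rfl
  have hδ (i : Fin 2) (x : T _⦋1⦌) :
      ev (T.δ i x) = singularEquiv Y 1 x (stdSimplex.vertex (1 - i)) := by
    change singularEquiv Y 0 (T.δ i x) _ = _
    rw [singularEquiv_δ, stdSimplex_map_succAbove_fin_two]
  choose sg hsg using exists_segment hι hconv
  let seg (a b : T _⦋0⦌) : T _⦋1⦌ := (singularEquiv Y 1).symm (sg (ev a) (ev b))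
  have hseg (a b) (s) : ι (singularEquiv Y 1 (seg a b) s) = s 0 • ι (ev a) + s 1 • ι (ev b) := by
    simp only [seg, Equiv.apply_symm_apply, hsg]
  refine SSet.nonempty_homology_one_addEquiv_abelianization p (G := G) ?_ ?_ (hlift 0) ?_ (hlift 1)
    ?_ (hlift 2) seg ?_ ?_ ?_ ?_ (pt y)
  · intro g a h
    refine IsCancelSMul.right_cancel _ _ (ev a) ?_
    rw [← hev, h, one_smul]
  · intro g a
    refine (singularEquiv X 0).injective (ContinuousMap.ext fun s => ?_)
    rw [hevp, hevp, hev, hq.map_smul]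
  · intro a b hab
    obtain ⟨g, hg⟩ := huniq 0 a b hab
    exact ⟨g, eqv.injective ((hg _).trans (hev g a).symm)⟩
  · intro a b hab
    obtain ⟨g, hg⟩ := huniq 1 a b hab
    refine ⟨g, eqv.injective ?_, eqv.injective ?_⟩
    · exact (hδ 0 b).trans ((hg _).trans ((hev g _).trans (congrArg (g • ·) (hδ 0 a))).symm)
    · exact (hδ 1 b).trans ((hg _).trans ((hev g _).trans (congrArg (g • ·) (hδ 1 a))).symm)
  · intro a b
    refine eqv.injective ((hδ 0 _).trans (hι.injective ?_))
    rw [hseg]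
    simp
    rfl
  · intro a b
    refine eqv.injective ((hδ 1 _).trans (hι.injective ?_))
    rw [hseg]
    simp
    rfl
  · intro g a b
    refine (singularEquiv X 1).injective (ContinuousMap.ext fun s => ?_)
    rw [hp, hp]
    refine Eq.trans (congrArg q ?_) (hq.map_smul g (e := singularEquiv Y 1 (seg a b) s))
    refine hι.injective ?_
    rw [hseg, hev, hev]
    exact (haff g _ _ _ _ _ (stdSimplex.add_eq_one s) (hseg a b s)).symm
  · intro a x
    obtain ⟨F, hF⟩ := exists_cone hι hconv (ev a) (singularEquiv Y 1 x)
    have hF' (i : Fin 3) (s : stdSimplex ℝ (Fin 2)) :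
        singularEquiv Y 1 (T.δ i ((singularEquiv Y 2).symm F)) s =
          F (stdSimplex.map (Fin.succAbove i) s) := by
      rw [singularEquiv_δ, Equiv.apply_symm_apply]
    refine ⟨(singularEquiv Y 2).symm F, ?_, ?_, ?_⟩ <;>
      refine (singularEquiv Y 1).injective (ContinuousMap.ext fun s => hι.injective ?_)
    · rw [hF', hF, stdSimplex_map_succAbove_zero_coe]
      simp [edgePoint_coe]
    · rw [hF', hF, stdSimplex_map_succAbove_one_coe, hseg, hδ]
      have h2 : 1 - s 0 = s 1 := by rw [← stdSimplex.add_eq_one s]; ring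
      simp only [Matrix.cons_val_zero, Matrix.cons_val, h2]
      congr 1
      -- At the apex both sides vanish; elsewhere the cone parameter is `s 1 / s 1 = 1`, the end of
      -- the edge.
      by_cases h : s 1 = 0
      · rw [h, zero_smul, zero_smul]
      · rw [div_self h, ← edgePoint_coe (stdSimplex.vertex (1 - 0))]
        simp
    · rw [hF', hF, stdSimplex_map_succAbove_two_coe, hseg, hδ]
      have h2 : 1 - s 0 = s 1 := by rw [← stdSimplex.add_eq_one s]; ring
      simp only [Matrix.cons_val_zero, Matrix.cons_val, h2, zero_div]
      rw [← edgePoint_coe (stdSimplex.vertex (1 - 1))]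
      simp

end SingularHomology

universe u

/-! ### The abelianization of the semidirect product. -/

section Abelianization

variable {K : Type u} [Field K] [NumberField K]

/-- The ideal generated by `v - 1` for a totally positive unit `v`. -/
noncomputable def unitIdeal (v : totallyPositiveUnits K) : Ideal (𝓞 K) :=
  Ideal.span {((v : (𝓞 K)ˣ) : 𝓞 K) - 1}

/-- Since `v ≡ 1` modulo `v - 1`, the image of `v`, and so of each of its powers, is trivial in the
unit group of the quotient. -/
lemma mk_unitIdeal_eq_one (v : totallyPositiveUnits K) (b : Subgroup.zpowers v) :
    Ideal.Quotient.mk (unitIdeal v) (((b : totallyPositiveUnits K) : (𝓞 K)ˣ) : 𝓞 K) = 1 := by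
  let f : totallyPositiveUnits K →* (𝓞 K ⧸ unitIdeal v)ˣ :=
    (Units.map (Ideal.Quotient.mk (unitIdeal v)).toMonoidHom).comp
      (totallyPositiveUnits K).subtype
  have hv : f v = 1 := by
    ext
    change Ideal.Quotient.mk (unitIdeal v) _ = Ideal.Quotient.mk (unitIdeal v) 1
    exact Ideal.Quotient.eq.2 (Ideal.subset_span rfl)
  obtain ⟨k, hk⟩ := b.2
  have hb : f b = 1 := by
    rw [← hk]
    simp [hv]
  exact congrArg Units.val hb

/-- The class of `(a, 1)` in the abelianization of `𝒪_K ⋊ U`. -/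
def abelianizationInl (U : Subgroup (totallyPositiveUnits K)) :
    𝓞 K →+ Additive (Abelianization (OTGroup U)) :=
  MonoidHom.toAdditiveRight (Abelianization.of.comp SemidirectProduct.inl)

/-- Conjugation by `b` acts on `𝒪_K` as multiplication by `b`, and conjugation is trivial in the
abelianization. -/
lemma abelianizationInl_mul (U : Subgroup (totallyPositiveUnits K)) (b : U) (a : 𝓞 K) :
    abelianizationInl U ((((b : totallyPositiveUnits K) : (𝓞 K)ˣ) : 𝓞 K) * a) =
      abelianizationInl U a := by
  have h := SemidirectProduct.inl_aut (φ := mulAction U) b (Multiplicative.ofAdd a)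
  have h' := congrArg Abelianization.of h
  rw [map_mul, map_mul, mul_right_comm, ← map_mul, ← map_mul Abelianization.of, ← map_mul,
    mul_inv_cancel, map_one, one_mul] at h'
  exact congrArg Additive.ofMul h'

/-- The abelianization of `𝒪_K ⋊ ⟨v⟩` is `𝒪_K / (v - 1) × ⟨v⟩`. -/
theorem nonempty_abelianization_addEquiv (v : totallyPositiveUnits K) :
    Nonempty (Additive (Abelianization (OTGroup (Subgroup.zpowers v))) ≃+
      (𝓞 K ⧸ unitIdeal v) × Additive (Subgroup.zpowers v)) := by
  set U := Subgroup.zpowers v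
  let f₀ : OTGroup U →* Multiplicative ((𝓞 K ⧸ unitIdeal v) × Additive U) :=
    SemidirectProduct.lift
      (AddMonoidHom.toMultiplicative ((AddMonoidHom.inl _ _).comp
        (Ideal.Quotient.mk (unitIdeal v)).toAddMonoidHom))
      (AddMonoidHom.toMultiplicativeRight (AddMonoidHom.inr _ _)) fun b => by
        refine MonoidHom.ext fun a => ?_
        obtain ⟨a, rfl⟩ := Multiplicative.ofAdd.surjective a
        have h : Ideal.Quotient.mk (unitIdeal v)
            ((((b : totallyPositiveUnits K) : (𝓞 K)ˣ) : 𝓞 K) * a) =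
            Ideal.Quotient.mk (unitIdeal v) a := by
          rw [map_mul, mk_unitIdeal_eq_one, one_mul]
        simp only [MonoidHom.comp_apply, MulEquiv.coe_toMonoidHom, MulAut.conj_apply,
          mul_inv_cancel_comm]
        exact congrArg (fun x => Multiplicative.ofAdd (AddMonoidHom.inl _ (Additive U) x)) h
  let f : Additive (Abelianization (OTGroup U)) →+ (𝓞 K ⧸ unitIdeal v) × Additive U :=
    MonoidHom.toAdditiveLeft (Abelianization.lift f₀)
  let g₁ : 𝓞 K ⧸ unitIdeal v →+ Additive (Abelianization (OTGroup U)) :=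
    QuotientAddGroup.lift (unitIdeal v).toAddSubgroup (abelianizationInl U) fun x hx => by
      obtain ⟨y, rfl⟩ := Ideal.mem_span_singleton'.1 hx
      have h := abelianizationInl_mul U ⟨v, Subgroup.mem_zpowers v⟩ y
      rw [AddMonoidHom.mem_ker, mul_sub, mul_one, map_sub, mul_comm, h, sub_self]
  let g₂ : Additive U →+ Additive (Abelianization (OTGroup U)) :=
    MonoidHom.toAdditive (Abelianization.of.comp SemidirectProduct.inr)
  let g := AddMonoidHom.coprod g₁ g₂
  have hfg₁ (a : 𝓞 K) : f (g₁ (Ideal.Quotient.mk _ a)) = (Ideal.Quotient.mk _ a, 0) := by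
    change (f₀ (SemidirectProduct.inl (Multiplicative.ofAdd a))).toAdd = _
    rw [SemidirectProduct.lift_inl]
    rfl
  have hfg₂ (b : U) : f (g₂ (Additive.ofMul b)) = (0, Additive.ofMul b) := by
    change (f₀ (SemidirectProduct.inr b)).toAdd = _
    rw [SemidirectProduct.lift_inr]
    rfl
  refine ⟨AddMonoidHom.toAddEquiv f g ?_ ?_⟩
  · refine AddMonoidHom.ext fun x => ?_
    obtain ⟨⟨a, b⟩, rfl⟩ : ∃ y : OTGroup U, Additive.ofMul (Abelianization.of y) = x := by
      obtain ⟨y, hy⟩ := QuotientGroup.mk_surjective x.toMul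
      exact ⟨y, congrArg Additive.ofMul hy⟩
    obtain ⟨a, rfl⟩ := Multiplicative.ofAdd.surjective a
    rw [SemidirectProduct.mk_eq_inl_mul_inr, map_mul, ofMul_mul, map_add]
    change g (f (g₁ (Ideal.Quotient.mk _ a))) + g (f (g₂ (Additive.ofMul b))) = _
    rw [hfg₁, hfg₂]
    simp only [g, AddMonoidHom.coprod_apply, map_zero, add_zero, zero_add]
    rfl
  · refine AddMonoidHom.ext fun ⟨x, b⟩ => ?_
    obtain ⟨a, rfl⟩ := Ideal.Quotient.mk_surjective x
    rw [AddMonoidHom.comp_apply, AddMonoidHom.coprod_apply, map_add, hfg₁]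
    refine (congrArg₂ (· + ·) rfl (hfg₂ b.toMul)).trans ?_
    simp

end Abelianization

/-! ### Torsion of a product of a finite and a torsion-free group. -/

section Torsion

lemma card_torsion_of_addEquiv {A B C : Type*} [AddCommGroup A] [AddCommGroup B]
    [AddCommGroup C] [Finite B] (hC : ∀ (c : C) (n : ℕ), 0 < n → n • c = 0 → c = 0)
    (e : A ≃+ B × C) :
    Finite (AddCommGroup.torsion A) ∧ Nat.card (AddCommGroup.torsion A) = Nat.card B := by
  have htors (a : A) : a ∈ AddCommGroup.torsion A ↔ (e a).2 = 0 := by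
    change IsOfFinAddOrder a ↔ _
    rw [isOfFinAddOrder_iff_nsmul_eq_zero]
    constructor
    · rintro ⟨n, hn, h⟩
      refine hC _ n hn ?_
      rw [← Prod.smul_snd, ← map_nsmul, h, map_zero, Prod.snd_zero]
    · intro h
      refine ⟨Nat.card B, Nat.card_pos, e.injective ?_⟩
      rw [map_nsmul, map_zero]
      ext
      · simp [card_nsmul_eq_zero']
      · simp [h]
  let E : AddCommGroup.torsion A ≃ B :=
    { toFun := fun a => (e a).1
      invFun := fun b => ⟨e.symm (b, 0), by rw [htors]; simp⟩
      left_inv := fun a => Subtype.ext (e.injective (by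
        rw [e.apply_symm_apply]
        exact Prod.ext rfl ((htors _).1 a.2).symm))
      right_inv := fun b => by simp }
  exact ⟨Finite.of_equiv _ E.symm, Nat.card_congr E⟩

end Torsion

/-! ### The covering of the Oeljeklaus–Toma manifold and the order of the torsion. -/

section Covering

variable {K : Type u} [Field K]

/-- The embedding of `ℍ^s × ℂ^t` into `ℂ^s × ℂ^t`. -/
def coverCoe (z : Cover K) : (RealPlace K → ℂ) × (ComplexPlace K → ℂ) :=
  (fun w => (z.1 w : ℂ), z.2)

lemma isEmbedding_coverCoe : Topology.IsEmbedding (coverCoe (K := K)) :=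
  (Topology.IsEmbedding.piMap fun _ => UpperHalfPlane.isEmbedding_coe).prodMap
    Topology.IsEmbedding.id

lemma range_coverCoe :
    Set.range (coverCoe (K := K)) = {p | ∀ w, 0 < (p.1 w).im} := by
  ext p
  constructor
  · rintro ⟨z, rfl⟩ w
    exact (z.1 w).im_pos
  · intro h
    exact ⟨(fun w => ⟨p.1 w, h w⟩, p.2), rfl⟩

lemma convex_range_coverCoe : Convex ℝ (Set.range (coverCoe (K := K))) := by
  rw [range_coverCoe]
  intro p hp q hq a b ha hb hab w
  have h := (convex_Ioi (0 : ℝ)) (hp w) (hq w) ha hb hab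
  simpa using h

variable [NumberField K]

/-- A totally positive unit as an element of the field. -/
def unitVal (v : totallyPositiveUnits K) : K := ((v : (𝓞 K)ˣ) : 𝓞 K)

lemma unitVal_pow (v : totallyPositiveUnits K) (n : ℕ) : unitVal (v ^ n) = unitVal v ^ n := by
  simp [unitVal]

lemma realEmb_unitVal_pos (v : totallyPositiveUnits K) (w : RealPlace K) :
    0 < realEmb w (unitVal v) :=
  v.2 (realEmb w)

variable {U : Subgroup (totallyPositiveUnits K)}

lemma coverCoe_smul_fst (g : OTGroup U) (z : Cover K) (w : RealPlace K) :
    (coverCoe (g • z)).1 w = (realEmb w (unitVal (g.right : totallyPositiveUnits K)) : ℂ) *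
      (coverCoe z).1 w + (realEmb w ((g.left.toAdd : 𝓞 K) : K) : ℂ) := by
  change ((realEmb w ((g.left.toAdd : 𝓞 K) : K) +ᵥ
        ((⟨realEmb w (unitVal (g.right : totallyPositiveUnits K)),
          realEmb_unitVal_pos _ _⟩ : {x : ℝ // 0 < x}) • z.1 w) : ℍ) : ℂ) = _
  rw [UpperHalfPlane.coe_vadd, UpperHalfPlane.coe_pos_real_smul, add_comm, Complex.real_smul]
  rfl

lemma coverCoe_smul_snd (g : OTGroup U) (z : Cover K) (w : ComplexPlace K) :
    (coverCoe (g • z)).2 w = complexEmb w (unitVal (g.right : totallyPositiveUnits K)) *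
      (coverCoe z).2 w + complexEmb w ((g.left.toAdd : 𝓞 K) : K) :=
  rfl

lemma coverCoe_smul_of_combination (g : OTGroup U) (a b y : Cover K) (s t : ℝ) (hst : s + t = 1)
    (h : coverCoe y = s • coverCoe a + t • coverCoe b) :
    coverCoe (g • y) = s • coverCoe (g • a) + t • coverCoe (g • b) := by
  have hst' : (s : ℂ) + t = 1 := by exact_mod_cast hst
  have h1 (w) : (coverCoe y).1 w = s * (coverCoe a).1 w + t * (coverCoe b).1 w := by
    rw [h]; simp
  have h2 (w) : (coverCoe y).2 w = s * (coverCoe a).2 w + t * (coverCoe b).2 w := by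
    rw [h]; simp
  ext w
  · simp only [Prod.fst_add, Prod.smul_fst, Pi.add_apply, Pi.smul_apply, coverCoe_smul_fst, h1,
      Complex.real_smul]
    linear_combination -(realEmb w ((g.left.toAdd : 𝓞 K) : K) : ℂ) * hst'
  · simp only [Prod.snd_add, Prod.smul_snd, Pi.add_apply, Pi.smul_apply, coverCoe_smul_snd, h2,
      Complex.real_smul]
    linear_combination -complexEmb w ((g.left.toAdd : 𝓞 K) : K) * hst'

instance continuousConstSMul_cover : ContinuousConstSMul (OTGroup U) (Cover K) where
  continuous_const_smul g := by
    refine (isEmbedding_coverCoe (K := K)).isInducing.continuous_iff.2 ?_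
    have hc := (isEmbedding_coverCoe (K := K)).continuous
    refine Continuous.prodMk (continuous_pi fun w => ?_) (continuous_pi fun w => ?_)
    · have h : Continuous fun z : Cover K => (coverCoe z).1 w :=
        (continuous_apply w).comp (continuous_fst.comp hc)
      exact ((continuous_const.mul h).add continuous_const).congr
        fun z => (coverCoe_smul_fst g z w).symm
    · have h : Continuous fun z : Cover K => (coverCoe z).2 w :=
        (continuous_apply w).comp (continuous_snd.comp hc)
      exact ((continuous_const.mul h).add continuous_const).congr
        fun z => (coverCoe_smul_snd g z w).symm

/-- A nonzero algebraic integer has norm of absolute value at least one, so it cannot be small at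
all places. -/
lemma eq_zero_of_forall_norm_lt_one (a : 𝓞 K) (h1 : ∀ w : RealPlace K, ‖realEmb w (a : K)‖ < 1)
    (h2 : ∀ w : ComplexPlace K, ‖complexEmb w (a : K)‖ < 1) : a = 0 := by
  have h (w : InfinitePlace K) : w (a : K) < 1 := by
    rcases w.isReal_or_isComplex with hw | hw
    · rw [← InfinitePlace.norm_embedding_of_isReal hw]
      exact h1 ⟨w, hw⟩
    · rw [← InfinitePlace.norm_embedding_eq]
      exact h2 ⟨w, hw⟩
  by_contra ha
  obtain ⟨w⟩ : Nonempty (InfinitePlace K) := inferInstance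
  exact absurd (InfinitePlace.one_le_of_lt_one ha fun z (_ : z ≠ w) => h z) (not_le.2 (h w))

/-- The logarithm of a real embedding as a homomorphism on totally positive units. -/
noncomputable def logEmb (w : RealPlace K) : Additive (totallyPositiveUnits K) →+ ℝ :=
  (Pi.evalAddMonoidHom (fun _ : RealPlace K => ℝ) w).comp (realLog K)

lemma logEmb_apply (w : RealPlace K) (v : totallyPositiveUnits K) :
    logEmb w (Additive.ofMul v) = Real.log (realEmb w (unitVal v)) :=
  rfl

lemma eq_one_of_abs_logEmb_lt (w : RealPlace K) (v : totallyPositiveUnits K)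
    (b : Subgroup.zpowers v)
    (hb : |logEmb w (Additive.ofMul (b : totallyPositiveUnits K))| <
      |logEmb w (Additive.ofMul v)|) : b = 1 := by
  obtain ⟨b, k, rfl⟩ := b
  simp only [ofMul_zpow, map_zsmul, zsmul_eq_mul, abs_mul] at hb
  have h0 : 0 ≤ |logEmb w (Additive.ofMul v)| := abs_nonneg _
  have hk : k = 0 := by
    by_contra hk
    have h1 : (1 : ℝ) ≤ |(k : ℝ)| := by exact_mod_cast Int.one_le_abs hk
    nlinarith
  subst hk
  exact Subtype.ext (zpow_zero v)

/-- An element `(a, b)` shifts `log Im` at `w₀` by `log σ(b)`, a multiple of `log σ(v) ≠ 0`. A small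
neighbourhood meeting its translate thus forces `b = 1`; what remains is a translation by an integer
small at all places, hence zero. -/
lemma isQuotientCoveringMap_mk (v : totallyPositiveUnits K) (w₀ : RealPlace K)
    (hv : logEmb w₀ (Additive.ofMul v) ≠ 0) :
    IsQuotientCoveringMap
      (Quotient.mk (MulAction.orbitRel (OTGroup (Subgroup.zpowers v)) (Cover K)))
      (OTGroup (Subgroup.zpowers v)) where
  toIsQuotientMap := isQuotientMap_quotient_mk'
  toContinuousConstSMul := inferInstance
  apply_eq_iff_mem_orbit := Quotient.eq''
  disjoint e := by
    let c := |logEmb w₀ (Additive.ofMul v)|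
    have hc : 0 < c := abs_pos.2 hv
    have hcont := (isEmbedding_coverCoe (K := K)).continuous
    have hc1 (w : RealPlace K) : Continuous fun z : Cover K => (coverCoe z).1 w :=
      (continuous_apply w).comp (continuous_fst.comp hcont)
    have hc2 (w : ComplexPlace K) : Continuous fun z : Cover K => (coverCoe z).2 w :=
      (continuous_apply w).comp (continuous_snd.comp hcont)
    have him (z : Cover K) : 0 < ((coverCoe z).1 w₀).im := (z.1 w₀).im_pos
    have hc3 : Continuous fun z : Cover K => Real.log ((coverCoe z).1 w₀).im :=
      (Complex.continuous_im.comp (hc1 w₀)).log fun z => (him z).ne'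
    -- The radii are halved so that two points of the neighbourhood differ by less than `1` in each
    -- coordinate and by less than `c` in `log Im`.
    refine ⟨{z | (∀ w, dist ((coverCoe z).1 w) ((coverCoe e).1 w) < 1 / 2) ∧
      (∀ w, dist ((coverCoe z).2 w) ((coverCoe e).2 w) < 1 / 2) ∧
      dist (Real.log ((coverCoe z).1 w₀).im) (Real.log ((coverCoe e).1 w₀).im) < c / 2}, ?_, ?_⟩
    · refine (eventually_all.2 fun w => ?_).and ((eventually_all.2 fun w => ?_).and ?_)
      · exact (hc1 w).continuousAt (Metric.ball_mem_nhds _ one_half_pos)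
      · exact (hc2 w).continuousAt (Metric.ball_mem_nhds _ one_half_pos)
      · exact hc3.continuousAt (Metric.ball_mem_nhds _ (half_pos hc))
    · rintro g ⟨_, ⟨z, ⟨hz1, hz2, hz3⟩, rfl⟩, hgz1, hgz2, hgz3⟩
      have hlog : Real.log ((coverCoe (g • z)).1 w₀).im =
          logEmb w₀ (Additive.ofMul (g.right : totallyPositiveUnits K)) +
            Real.log ((coverCoe z).1 w₀).im := by
        rw [logEmb_apply, ← Real.log_mul (realEmb_unitVal_pos _ _).ne' (him z).ne',
          coverCoe_smul_fst, Complex.add_im, Complex.im_ofReal_mul, Complex.ofReal_im, add_zero]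
      have hright : g.right = 1 := by
        refine eq_one_of_abs_logEmb_lt w₀ v g.right ?_
        have h := dist_triangle_right (Real.log ((coverCoe (g • z)).1 w₀).im)
          (Real.log ((coverCoe z).1 w₀).im) (Real.log ((coverCoe e).1 w₀).im)
        rw [hlog, Real.dist_eq, add_sub_cancel_right, ← hlog] at h
        change _ < c
        linarith
      have hleft : g.left.toAdd = 0 := by
        refine eq_zero_of_forall_norm_lt_one _ (fun w => ?_) fun w => ?_
        · have hd : dist ((coverCoe (g • z)).1 w) ((coverCoe z).1 w) =
              ‖realEmb w ((g.left.toAdd : 𝓞 K) : K)‖ := by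
            rw [dist_eq_norm, coverCoe_smul_fst, hright]
            simp only [unitVal, OneMemClass.coe_one, Units.val_one, map_one, Complex.ofReal_one,
              one_mul, add_sub_cancel_left, Complex.norm_real]
          rw [← hd]
          exact (dist_triangle_right _ _ ((coverCoe e).1 w)).trans_lt
            ((add_lt_add (hgz1 w) (hz1 w)).trans_eq (add_halves 1))
        · have hd : dist ((coverCoe (g • z)).2 w) ((coverCoe z).2 w) =
              ‖complexEmb w ((g.left.toAdd : 𝓞 K) : K)‖ := by
            rw [dist_eq_norm, coverCoe_smul_snd, hright]
            simp only [unitVal, OneMemClass.coe_one, Units.val_one, map_one,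
              one_mul, add_sub_cancel_left]
          rw [← hd]
          exact (dist_triangle_right _ _ ((coverCoe e).2 w)).trans_lt
            ((add_lt_add (hgz2 w) (hz2 w)).trans_eq (add_halves 1))
      exact SemidirectProduct.ext hleft hright

theorem nonempty_H1_X_addEquiv (v : totallyPositiveUnits K) (w₀ : RealPlace K)
    (hv : logEmb w₀ (Additive.ofMul v) ≠ 0) :
    Nonempty (H1 (X (Subgroup.zpowers v)) ≃+
      (𝓞 K ⧸ unitIdeal v) × Additive (Subgroup.zpowers v)) := by
  classical
  obtain ⟨e₁⟩ := nonempty_H1_addEquiv_abelianization (isQuotientCoveringMap_mk v w₀ hv)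
    isEmbedding_coverCoe convex_range_coverCoe coverCoe_smul_of_combination
    ((fun _ => UpperHalfPlane.I, 0) : Cover K)
  obtain ⟨e₂⟩ := nonempty_abelianization_addEquiv v
  exact ⟨e₁.trans e₂⟩

theorem card_torsion_H1_X (v : totallyPositiveUnits K) (w₀ : RealPlace K)
    (hv : logEmb w₀ (Additive.ofMul v) ≠ 0) :
    Finite (AddCommGroup.torsion (H1 (X (Subgroup.zpowers v)))) ∧
      (Nat.card (AddCommGroup.torsion (H1 (X (Subgroup.zpowers v)))) : ℝ) =
        ∏ w : InfinitePlace K, w (unitVal v - 1) ^ w.mult := by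
  obtain ⟨e⟩ := nonempty_H1_X_addEquiv v w₀ hv
  have hne : ((v : (𝓞 K)ˣ) : 𝓞 K) - 1 ≠ 0 := by
    intro h
    apply hv
    rw [logEmb_apply, unitVal, sub_eq_zero.1 h]
    simp
  have hcard : Nat.card (𝓞 K ⧸ unitIdeal v) =
      (Algebra.norm ℤ (((v : (𝓞 K)ˣ) : 𝓞 K) - 1)).natAbs := by
    rw [← Ideal.absNorm_span_singleton, Ideal.absNorm_apply, Submodule.cardQuot_apply]
    rfl
  have hfin : Finite (𝓞 K ⧸ unitIdeal v) := by
    refine Nat.finite_of_card_ne_zero ?_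
    rw [hcard]
    simpa [Algebra.norm_eq_zero_iff] using hne
  -- The logarithm at `w₀` is injective on `⟨v⟩` and takes values in the torsion-free group `ℝ`.
  have hC (c : Additive (Subgroup.zpowers v)) (n : ℕ) (hn : 0 < n) (hc : n • c = 0) : c = 0 := by
    refine eq_one_of_abs_logEmb_lt w₀ v c.toMul ?_
    have h : (n : ℝ) * logEmb w₀ (Additive.ofMul (c.toMul : totallyPositiveUnits K)) = 0 := by
      have h' := congrArg (fun x : Additive (Subgroup.zpowers v) =>
        logEmb w₀ (Additive.ofMul (x.toMul : totallyPositiveUnits K))) hc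
      simpa using h'
    have h3 := (mul_eq_zero.1 h).resolve_left (Nat.cast_ne_zero.2 hn.ne')
    rw [h3, abs_zero]
    exact abs_pos.2 hv
  obtain ⟨h1, h2⟩ := card_torsion_of_addEquiv hC e
  refine ⟨h1, ?_⟩
  rw [h2, hcard, InfinitePlace.prod_eq_abs_norm]
  have h := Algebra.coe_norm_int (((v : (𝓞 K)ˣ) : 𝓞 K) - 1)
  have h' : unitVal v - 1 = ((((v : (𝓞 K)ˣ) : 𝓞 K) - 1 : 𝓞 K) : K) := by
    simp [unitVal]
  rw [h', ← h, Nat.cast_natAbs]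
  push_cast
  rfl

end Covering

/-! ### The Mahler measure as a product over infinite places. -/

section Mahler

variable {K : Type u} [Field K] [NumberField K]

lemma prod_embeddings_eq_prod_infinitePlace (f : ℝ → ℝ) (x : K) :
    ∏ φ : K →+* ℂ, f ‖φ x‖ = ∏ w : InfinitePlace K, f (w x) ^ w.mult := by
  classical
  rw [← Finset.prod_fiberwise Finset.univ InfinitePlace.mk (fun φ => f ‖φ x‖)]
  have h (w : InfinitePlace K) (φ) (hφ : φ ∈ Finset.univ.filter fun φ => InfinitePlace.mk φ = w) :
      f ‖φ x‖ = f (w x) := by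
    rw [← (Finset.mem_filter.mp hφ).2, InfinitePlace.apply]
  simp_rw [Finset.prod_congr rfl (h _), Finset.prod_const, InfinitePlace.card_filter_mk_eq]

/-- The Mahler measure of the minimal polynomial of an integral generator of a number field. -/
lemma mahlerMeasure_minpoly_eq_prod (x : K)
    (hdeg : (minpoly ℚ x).natDegree = Module.finrank ℚ K) :
    ((minpoly ℚ x).map (algebraMap ℚ ℂ)).mahlerMeasure =
      ∏ w : InfinitePlace K, max 1 (w x) ^ w.mult := by
  classical
  have hint : IsIntegral ℚ x := Algebra.IsIntegral.isIntegral x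
  have hsep : (minpoly ℚ x).Separable := (minpoly.irreducible hint).separable
  have hmonic : ((minpoly ℚ x).map (algebraMap ℚ ℂ)).Monic := (minpoly.monic hint).map _
  have hnodup : ((minpoly ℚ x).map (algebraMap ℚ ℂ)).roots.Nodup :=
    Polynomial.nodup_roots hsep.map
  have himage : Finset.univ.image (fun φ : K →+* ℂ => φ x) =
      ((minpoly ℚ x).map (algebraMap ℚ ℂ)).roots.toFinset := by
    have h := Embeddings.range_eval_eq_rootSet_minpoly K ℂ x
    rw [← Finset.coe_inj, Finset.coe_image, Finset.coe_univ, Set.image_univ, h,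
      Polynomial.rootSet_def, Polynomial.aroots_def]
  -- By the degree hypothesis there are as many simple roots as embeddings, so distinct embeddings
  -- take distinct values at `x`.
  have hcard : (Finset.univ.image (fun φ : K →+* ℂ => φ x)).card =
      (Finset.univ : Finset (K →+* ℂ)).card := by
    rw [himage, Multiset.toFinset_card_of_nodup hnodup, Finset.card_univ, Embeddings.card, ← hdeg,
      ← Polynomial.natDegree_map (algebraMap ℚ ℂ)]
    exact (IsAlgClosed.splits _).natDegree_eq_card_roots.symm
  have hinj := Finset.card_image_iff.1 hcard
  rw [Polynomial.mahlerMeasure_eq_leadingCoeff_mul_prod_roots, hmonic.leadingCoeff, norm_one,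
    one_mul, ← prod_embeddings_eq_prod_infinitePlace (fun t => max 1 t),
    ← Finset.prod_image (f := fun z : ℂ => max 1 ‖z‖) hinj, himage, Finset.prod_eq_multiset_prod,
    Multiset.toFinset_val, hnodup.dedup]

end Mahler

/-! ### Asymptotics of `∏ |x ^ n - 1|`. -/

section Asymptotics

/-- Inside the unit disc `z ^ n` tends to zero; outside it, dividing by `z ^ n` leaves `1 - z⁻¹ ^
n`. -/
lemma tendsto_norm_pow_sub_one_div {𝕜 : Type*} [NormedField 𝕜] (z : 𝕜) (hz : ‖z‖ ≠ 1) :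
    Tendsto (fun n : ℕ => ‖z ^ n - 1‖ / max 1 ‖z‖ ^ n) atTop (nhds 1) := by
  rcases lt_or_gt_of_ne hz with h | h
  · have h1 := ((tendsto_pow_atTop_nhds_zero_of_norm_lt_one h).sub_const 1).norm
    simpa [max_eq_left h.le] using h1
  · have hz0 : z ≠ 0 := norm_pos_iff.1 (zero_lt_one.trans h)
    have h0 : ‖z⁻¹‖ < 1 := by
      rw [norm_inv]
      exact inv_lt_one_of_one_lt₀ h
    have h1 := ((tendsto_pow_atTop_nhds_zero_of_norm_lt_one h0).const_sub 1).norm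
    rw [sub_zero, norm_one] at h1
    refine h1.congr fun n => ?_
    rw [max_eq_right h.le, ← norm_pow, ← norm_div, sub_div, div_self (pow_ne_zero n hz0), inv_pow,
      one_div]

lemma tendsto_log_div_of_isEquivalent_pow {c : ℕ → ℝ} {M : ℝ} (hM : 0 < M)
    (h : Asymptotics.IsEquivalent atTop c (fun n => M ^ n)) :
    Tendsto (fun n : ℕ => Real.log (c n) / n) atTop (nhds (Real.log M)) := by
  have hne : ∀ᶠ n : ℕ in atTop, M ^ n ≠ 0 := Eventually.of_forall fun n => (pow_pos hM n).ne'
  have h1 := (Asymptotics.isEquivalent_iff_tendsto_one hne).1 h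
  have h2 : Tendsto (fun n : ℕ => Real.log (c n / M ^ n)) atTop (nhds 0) := by
    simpa using! h1.log one_ne_zero
  have h3 : Tendsto (fun n : ℕ => Real.log (c n / M ^ n) / n + Real.log M) atTop
      (nhds (Real.log M)) := by
    simpa using (h2.div_atTop tendsto_natCast_atTop_atTop).add_const (Real.log M)
  refine h3.congr' ?_
  -- A ratio above `1 / 2` ensures `c n ≠ 0`, so that the logarithm of the quotient splits.
  filter_upwards [h1.eventually (lt_mem_nhds one_half_lt_one), eventually_gt_atTop 0] with n hn hn0
  have hn0' : (n : ℝ) ≠ 0 := Nat.cast_ne_zero.2 hn0.ne'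
  have hc : c n ≠ 0 := by
    intro hc
    rw [Pi.div_apply, hc, zero_div] at hn
    linarith
  rw [Real.log_div hc (pow_pos hM n).ne', Real.log_pow]
  field_simp
  ring

variable {K : Type u} [Field K] [NumberField K]

lemma isEquivalent_prod_infinitePlace_pow_sub_one (x : K) (hx : ∀ w : InfinitePlace K, w x ≠ 1) :
    Asymptotics.IsEquivalent atTop
      (fun n : ℕ => ∏ w : InfinitePlace K, w (x ^ n - 1) ^ w.mult)
      (fun n : ℕ => (∏ w : InfinitePlace K, max 1 (w x) ^ w.mult) ^ n) := by
  have hpos : 0 < ∏ w : InfinitePlace K, max 1 (w x) ^ w.mult :=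
    Finset.prod_pos fun w _ => pow_pos (zero_lt_one.trans_le (le_max_left _ _)) _
  rw [Asymptotics.isEquivalent_iff_tendsto_one
    (Eventually.of_forall fun n => (pow_pos hpos n).ne')]
  have h (w : InfinitePlace K) : Tendsto (fun n : ℕ => (w (x ^ n - 1) / max 1 (w x) ^ n) ^ w.mult)
      atTop (nhds 1) := by
    have h1 := (tendsto_norm_pow_sub_one_div (w.embedding x)
      (by rw [InfinitePlace.norm_embedding_eq]; exact hx w)).pow w.mult
    simpa only [← map_pow, ← map_one w.embedding, ← map_sub, InfinitePlace.norm_embedding_eq,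
      one_pow] using h1
  have h2 := tendsto_finsetProd Finset.univ fun w _ => h w
  rw [Finset.prod_const_one] at h2
  refine h2.congr fun n => ?_
  rw [Pi.div_apply, ← Finset.prod_pow, ← Finset.prod_div_distrib]
  refine Finset.prod_congr rfl fun w _ => ?_
  rw [div_pow, pow_right_comm]

end Asymptotics

/-! ### Totally positive units and admissibility. -/

section Units

variable {K : Type u} [Field K] [NumberField K]

/-- Squares of units are totally positive. Were they all trivial, every unit would be torsion,
against Dirichlet's unit theorem in positive rank. -/
lemma exists_totallyPositiveUnit_ne_one (h : 0 < Units.rank K) :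
    ∃ v : totallyPositiveUnits K, v ≠ 1 := by
  by_contra! hall
  have htors (v : (𝓞 K)ˣ) : v ∈ Units.torsion K := by
    have hsq : v ^ 2 ∈ totallyPositiveUnits K := fun σ => by
      have : σ ((v : 𝓞 K) : K) ≠ 0 := by simp
      have hp : σ (((v ^ 2 : (𝓞 K)ˣ) : 𝓞 K) : K) = σ ((v : 𝓞 K) : K) ^ 2 := by simp
      rw [hp]
      positivity
    have h1 : v ^ 2 = 1 := congrArg Subtype.val (hall ⟨_, hsq⟩)
    exact isOfFinOrder_iff_pow_eq_one.2 ⟨2, two_pos, h1⟩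
  have hsub : Subsingleton ((𝓞 K)ˣ ⧸ Units.torsion K) :=
    ⟨fun a b => by
      obtain ⟨a, rfl⟩ := QuotientGroup.mk_surjective a
      obtain ⟨b, rfl⟩ := QuotientGroup.mk_surjective b
      exact QuotientGroup.eq.2 (htors _)⟩
  have h0 := Units.finrank_modTorsion K
  rw [Module.finrank_eq_zero_of_subsingleton] at h0
  omega

lemma logEmb_ne_zero_of_zpowers_eq_top (h : 0 < Units.rank K) (u : totallyPositiveUnits K)
    (hu : Subgroup.zpowers u = ⊤) (w : RealPlace K) : logEmb w (Additive.ofMul u) ≠ 0 := by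
  intro h0
  rw [logEmb_apply] at h0
  have h1 : realEmb w (unitVal u) = 1 :=
    Real.eq_one_of_pos_of_log_eq_zero (realEmb_unitVal_pos u w) h0
  have h2 : unitVal u = 1 := (realEmb w).injective (h1.trans (map_one _).symm)
  have h3 : u = 1 := by
    refine Subtype.ext (Units.ext (RingOfIntegers.ext ?_))
    exact h2
  obtain ⟨v, hv⟩ := exists_totallyPositiveUnit_ne_one h
  apply hv
  have : v ∈ Subgroup.zpowers u := by rw [hu]; trivial
  rwa [h3, Subgroup.zpowers_one_eq_bot, Subgroup.mem_bot] at this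

lemma logEmb_pow_ne_zero {u : totallyPositiveUnits K} {w : RealPlace K}
    (h : logEmb w (Additive.ofMul u) ≠ 0) {n : ℕ} (hn : 1 ≤ n) :
    logEmb w (Additive.ofMul (u ^ n)) ≠ 0 := by
  rw [ofMul_pow, map_nsmul, nsmul_eq_mul]
  exact mul_ne_zero (Nat.cast_ne_zero.2 (by omega)) h

lemma infinitePlace_eq_or_eq (hs : InfinitePlace.nrRealPlaces K = 1)
    (ht : InfinitePlace.nrComplexPlaces K = 1) :
    ∃ (w₀ : RealPlace K) (w₁ : ComplexPlace K), (∀ w : RealPlace K, w = w₀) ∧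
      ∀ w : InfinitePlace K, w = w₀ ∨ w = w₁ := by
  classical
  obtain ⟨w₀, h₀⟩ := Fintype.card_eq_one_iff.1 hs
  obtain ⟨w₁, h₁⟩ := Fintype.card_eq_one_iff.1 ht
  refine ⟨w₀, w₁, h₀, fun w => ?_⟩
  rcases w.isReal_or_isComplex with hw | hw
  · exact Or.inl (congrArg Subtype.val (h₀ ⟨w, hw⟩))
  · exact Or.inr (congrArg Subtype.val (h₁ ⟨w, hw⟩))

lemma isAdmissible_zpowers (hs : InfinitePlace.nrRealPlaces K = 1) (v : totallyPositiveUnits K)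
    (w₀ : RealPlace K) (hw : ∀ w : RealPlace K, w = w₀) (hv : logEmb w₀ (Additive.ofMul v) ≠ 0) :
    IsAdmissible (Subgroup.zpowers v) := by
  let f : ℤ →ₗ[ℤ] Additive (Subgroup.zpowers v) :=
    LinearMap.toSpanSingleton ℤ _ (Additive.ofMul ⟨v, Subgroup.mem_zpowers v⟩)
  have hf : Function.Bijective f := by
    constructor
    · rw [injective_iff_map_eq_zero]
      intro k hk
      have h : logEmb w₀ (Additive.ofMul (((f k).toMul : Subgroup.zpowers v) :
          totallyPositiveUnits K)) = 0 := by
        rw [hk]; simp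
      have h' : (k : ℝ) * logEmb w₀ (Additive.ofMul v) = 0 := by
        rw [← h]; simp [f]
      exact_mod_cast (mul_eq_zero.1 h').resolve_right hv
    · rintro ⟨_, k, rfl⟩
      exact ⟨k, rfl⟩
  let e := LinearEquiv.ofBijective f hf
  have hmem (x : (Subgroup.toAddSubgroup (Subgroup.zpowers v)).map (realLog K)) :
      ∃ k : ℤ, (x : RealPlace K → ℝ) = k • realLog K (Additive.ofMul v) := by
    obtain ⟨b, ⟨k, hk⟩, hb⟩ := x.2
    refine ⟨k, ?_⟩
    rw [← hb, ← map_zsmul]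
    exact congrArg (realLog K) hk.symm
  refine ⟨Module.Free.of_equiv e, Module.Finite.equiv e, ?_, ?_, ?_⟩
  · rw [hs, ← e.finrank_eq, Module.finrank_self]
  · refine discreteTopology_of_isOpen_singleton_zero ?_
    -- The image consists of the integer multiples of `log v`, so only zero is shorter than `|log
    -- v|`.
    have hopen : IsOpen {x : (Subgroup.toAddSubgroup (Subgroup.zpowers v)).map (realLog K) |
        |(x : RealPlace K → ℝ) w₀| < |logEmb w₀ (Additive.ofMul v)|} :=
      isOpen_lt ((continuous_apply w₀).comp continuous_subtype_val).abs continuous_const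
    convert! hopen
    ext x
    constructor
    · rintro rfl
      simpa using hv
    · intro hx
      obtain ⟨k, hk⟩ := hmem x
      have hx' : |(k : ℝ) * logEmb w₀ (Additive.ofMul v)| < |logEmb w₀ (Additive.ofMul v)| := by
        have h := hx
        rw [Set.mem_ofPred_eq, hk] at h
        simpa [logEmb] using h
      have hk0 : k = 0 := by
        by_contra hk0
        rw [abs_mul] at hx'
        have h1 : (1 : ℝ) ≤ |(k : ℝ)| := by exact_mod_cast Int.one_le_abs hk0
        nlinarith [abs_nonneg (logEmb w₀ (Additive.ofMul v))]
      refine Subtype.ext ?_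
      rw [hk, hk0, zero_smul]
      rfl
  · refine eq_top_iff.2 fun g _ => ?_
    have hg : g = (g w₀ / logEmb w₀ (Additive.ofMul v)) • realLog K (Additive.ofMul v) := by
      ext w
      rw [hw w]
      exact (div_mul_cancel₀ _ hv).symm
    rw [hg]
    exact Submodule.smul_mem _ _ (Submodule.subset_span
      ⟨Additive.ofMul v, Subgroup.mem_zpowers v, rfl⟩)

lemma natDegree_minpoly_eq_finrank (x : K) (hprime : (Module.finrank ℚ K).Prime)
    (hx : x ∉ (algebraMap ℚ K).range) : (minpoly ℚ x).natDegree = Module.finrank ℚ K := by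
  have hdvd := minpoly.degree_dvd (K := ℚ) (Algebra.IsIntegral.isIntegral x)
  exact ((Nat.dvd_prime hprime).1 hdvd).resolve_left fun h => hx (minpoly.natDegree_eq_one_iff.1 h)

end Units

end OT

/-! ### The cubic case with one real and one complex place. -/

theorem mainTheorem3 (K : Type*) [Field K] [NumberField K]
    (hs : InfinitePlace.nrRealPlaces K = 1) (ht : InfinitePlace.nrComplexPlaces K = 1)
    (u : OT.totallyPositiveUnits K) (hu : Subgroup.zpowers u = ⊤) :
    (∀ n : ℕ, 1 ≤ n → OT.IsAdmissible (Subgroup.zpowers (u ^ n))) ∧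
    (∀ n : ℕ, 1 ≤ n →
      Finite (AddCommGroup.torsion (OT.H1 (OT.X (Subgroup.zpowers (u ^ n)))))) ∧
    Tendsto (fun n : ℕ =>
        Real.log (Nat.card (AddCommGroup.torsion (OT.H1 (OT.X (Subgroup.zpowers (u ^ n)))))) / n)
      atTop
      (nhds (Real.log
        ((minpoly ℚ (((u : (𝓞 K)ˣ) : 𝓞 K) : K)).map (algebraMap ℚ ℂ)).mahlerMeasure)) ∧
    1 < ((minpoly ℚ (((u : (𝓞 K)ˣ) : 𝓞 K) : K)).map (algebraMap ℚ ℂ)).mahlerMeasure ∧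
    Asymptotics.IsEquivalent atTop
      (fun n : ℕ =>
        (Nat.card (AddCommGroup.torsion (OT.H1 (OT.X (Subgroup.zpowers (u ^ n))))) : ℝ))
      (fun n : ℕ =>
        ((minpoly ℚ (((u : (𝓞 K)ˣ) : 𝓞 K) : K)).map (algebraMap ℚ ℂ)).mahlerMeasure ^ n) := by
  obtain ⟨w₀, w₁, hw₀, hw⟩ := OT.infinitePlace_eq_or_eq hs ht
  have hrank : 0 < Units.rank K := by
    rw [Units.rank, InfinitePlace.card_eq_nrRealPlaces_add_nrComplexPlaces, hs, ht]
    exact one_pos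
  have hlog := OT.logEmb_ne_zero_of_zpowers_eq_top hrank u hu w₀
  let x : K := OT.unitVal u
  have hw₀x : w₀.1 x ≠ 1 := by
    rw [← InfinitePlace.norm_embedding_of_isReal w₀.2, Real.norm_of_nonneg
      (OT.realEmb_unitVal_pos u w₀).le]
    intro h
    exact hlog (by rw [OT.logEmb_apply]; exact Real.log_eq_zero.2 (Or.inr (Or.inl h)))
  have hne : w₀.1 ≠ w₁.1 := fun h =>
    InfinitePlace.not_isReal_iff_isComplex.2 w₁.2 (h ▸ w₀.2)
  have hprod (f : InfinitePlace K → ℝ) : ∏ w, f w ^ w.mult = f w₀ * f w₁ ^ 2 := by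
    classical
    have huniv : (Finset.univ : Finset (InfinitePlace K)) = {w₀.1, w₁.1} := by
      ext w
      simpa using hw w
    rw [huniv, Finset.prod_pair hne, InfinitePlace.mult_isReal, InfinitePlace.mult_isComplex,
      pow_one]
  have hnorm : w₀.1 x * w₁.1 x ^ 2 = 1 := by
    rw [← hprod fun w => w x, InfinitePlace.prod_eq_abs_norm]
    exact_mod_cast Units.norm K u.1
  have hx₀ : x ≠ 0 := by
    intro h
    rw [h, map_zero, zero_mul] at hnorm
    exact zero_ne_one hnorm
  have hpos (w : InfinitePlace K) : 0 < w x := InfinitePlace.pos_iff.2 hx₀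
  have hx1 (w : InfinitePlace K) : w x ≠ 1 := by
    rcases hw w with rfl | rfl
    · exact hw₀x
    · intro h
      rw [h, one_pow, mul_one] at hnorm
      exact hw₀x hnorm
  have hfin : Module.finrank ℚ K = 3 := by
    rw [← InfinitePlace.card_add_two_mul_card_eq_rank, hs, ht]
  -- A rational `x` has the same absolute value at both places, so the norm relation makes its cube
  -- `1`, against `hw₀x`.
  have hrat : x ∉ (algebraMap ℚ K).range := by
    rintro ⟨r, hr⟩
    have hr' (w : InfinitePlace K) : w x = |(r : ℝ)| := by
      rw [← InfinitePlace.norm_embedding_eq, ← hr, eq_ratCast, map_ratCast]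
      simp
    rw [hr', hr'] at hnorm
    refine hw₀x ?_
    rw [hr']
    refine (pow_eq_one_iff_of_nonneg (abs_nonneg _) three_ne_zero).1 ?_
    rw [← hnorm]
    ring
  have hM : ((minpoly ℚ x).map (algebraMap ℚ ℂ)).mahlerMeasure =
      ∏ w : InfinitePlace K, max 1 (w x) ^ w.mult :=
    OT.mahlerMeasure_minpoly_eq_prod x
      (OT.natDegree_minpoly_eq_finrank x (hfin ▸ Nat.prime_three) hrat)
  have hM1 : 1 < ((minpoly ℚ x).map (algebraMap ℚ ℂ)).mahlerMeasure := by
    rw [hM, hprod]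
    rcases lt_or_gt_of_ne hw₀x with h | h
    · have h1 : 1 < w₁.1 x := by
        by_contra! h1
        have h2 := mul_le_of_le_one_right (hpos w₀.1).le
          (pow_le_one₀ (hpos w₁.1).le h1 (n := 2))
        linarith
      rw [max_eq_left h.le, max_eq_right h1.le, one_mul]
      exact one_lt_pow₀ h1 two_ne_zero
    · rw [max_eq_right h.le]
      exact one_lt_mul_of_lt_of_le h (one_le_pow₀ (le_max_left _ _))
  have hequiv : Asymptotics.IsEquivalent atTop
      (fun n : ℕ =>
        (Nat.card (AddCommGroup.torsion (OT.H1 (OT.X (Subgroup.zpowers (u ^ n))))) : ℝ))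
      (fun n : ℕ => ((minpoly ℚ x).map (algebraMap ℚ ℂ)).mahlerMeasure ^ n) := by
    rw [hM]
    refine (OT.isEquivalent_prod_infinitePlace_pow_sub_one x hx1).congr_left ?_
    -- The index `n = 0` is excluded: there the unit is `1`, and its logarithm vanishes.
    filter_upwards [eventually_ge_atTop 1] with n hn
    rw [(OT.card_torsion_H1_X (u ^ n) w₀ (OT.logEmb_pow_ne_zero hlog hn)).2, OT.unitVal_pow]
  exact ⟨fun n hn => OT.isAdmissible_zpowers hs _ w₀ hw₀ (OT.logEmb_pow_ne_zero hlog hn),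
    fun n hn => (OT.card_torsion_H1_X (u ^ n) w₀ (OT.logEmb_pow_ne_zero hlog hn)).1,
    OT.tendsto_log_div_of_isEquivalent_pow (zero_lt_one.trans hM1) hequiv, hM1, hequiv⟩
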